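/- Let $G$ be a finite group and $R$ a commutative ring with a unital partial action $\alpha=(D_g,\alpha_g)_{g\in G}$ of $G$: each $D_g=R1_g$ is the ideal generated by an idempotent $1_g$ (possibly zero), each $\alpha_g\colon D_{g^{-1}}\to D_g$ is a ring isomorphism, $D_1=R$, $\alpha_1=\mathrm{id}_R$, $\alpha_g(D_{g^{-1}}D_h)=D_gD_{gh}$, and $\alpha_g(\alpha_h(t))=\alpha_{gh}(t)$ for $t\in D_{h^{-1}}D_{(gh)^{-1}}$. Let $R^\alpha=\{r\in R : \alpha_g(r1_{g^{-1}})=r1_g \text{ for all } g\in G\}$, and suppose that $R\supseteq R^\alpha$ is an $\alpha$-partial Galois extension, i.e. there are $m\in\mathbb N$ and $x_1,y_1,\dots,x_m,y_m\in R$ with $\sum_{i=1}^m x_i\alpha_g(y_i1_{g^{-1}})=\delta_{1,g}$ for all $g\in G$. Let $C^1$ be the group, under pointwise multiplication, of functions $f\colon G\to R$ such that $f(g)$ is a unit of the ring $R1_g$ for all $g$; let $Z^1(G,\alpha,R)$ be the subgroup of those $f$ with $f(gh)1_g=f(g)\,\alpha_g(f(h)1_{g^{-1}})$ for all $g,h\in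 G$, let $B^1(G,\alpha,R)$ be the subgroup of the functions $g\mapsto\alpha_g(t1_{g^{-1}})t^{-1}$ with $t$ a unit of $R$, and let $H^1(G,\alpha,R)=Z^1(G,\alpha,R)/B^1(G,\alpha,R)$; write $\mathrm{cls}(f)$ for the class of $f$. Let $R\star_\alpha G$ be the partial skew group ring of all formal sums $\sum_{g\in G}r_g\delta_g$, $r_g\in D_g$, with multiplication $(r_g\delta_g)(r'_h\delta_h)=r_g\alpha_g(r'_h1_{g^{-1}})\delta_{gh}$. For $f\in Z^1(G,\alpha,R)$ let $R_f$ be the $R\star_\alpha G$-module with underlying additive group $R$ and action $(r_g\delta_g)\cdot r=r_gf(g)\alpha_g(r1_{g^{-1}})$. For an $R\star_\alpha G$-module $M$ let $M^G=\{m\in M : (1_g\delta_g)m=1_gm \text{ for all } g\in G\}$, where $R$ acts on $M$ through $r\mapsto r\delta_1$; it is an $R^\alpha$-module. Then for every $f\in Z^1(G,\alpha,R)$ the $R^\alpha$-module $R_f^G=(R_f)^G$ is finitely generated projective of rank $1$, and $\mathrm{cls}(f)\mapsto[R_f^G]$ is a well-defined group homomorphism $\varphi_1\colon H^1(G,\alpha,R)\to\mathbf{Pic}(R^\alpha)$,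 where $\mathbf{Pic}(R^\alpha)$ is the group of isomorphism classes of finitely generated projective $R^\alpha$-modules of rank $1$ under tensor product. -/

import Mathlib

open scoped DirectSum

/-- A unital (non twisted) partial action `α = (D_g, α_g)_{g ∈ G}` of a group `G` on a commutative
ring `R`: each `D_g` is the ideal of `R` generated by an idempotent `1_g` (written `e g`, possibly
zero) and `α_g : D_{g⁻¹} → D_g` is a ring isomorphism. -/
structure UnitalPartialAction (G R : Type*) [Group G] [CommRing R] where
  /-- The ideal `D_g`. -/
  D : G → Ideal R
  /-- The idempotent `1_g`. -/
  e : G → R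
  e_idem : ∀ g, IsIdempotentElem (e g)
  D_eq : ∀ g, D g = Ideal.span {e g}
  /-- The isomorphism `α_g : D_{g⁻¹} → D_g`. -/
  iso : ∀ g, D g⁻¹ ≃+* D g
  D_one : D 1 = ⊤
  /-- `α_1` is the identity map. -/
  iso_one : ∀ x : D (1 : G)⁻¹, (iso 1 x : R) = (x : R)
  /-- `α_g (D_{g⁻¹} D_h) = D_g D_{gh}`. -/
  image_iso : ∀ g h : G,
    (fun x : D g⁻¹ => (iso g x : R)) '' {x | (x : R) ∈ D g⁻¹ * D h} =
      ((D g * D (g * h) : Ideal R) : Set R)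
  /-- `α_g (α_h t) = α_{gh} t` for `t ∈ D_{h⁻¹} D_{(gh)⁻¹}`. By `image_iso` the hypothesis
  `ht'`, which only makes the left-hand side meaningful, is automatic. -/
  iso_iso : ∀ (g h : G) (t : R) (ht : t ∈ D h⁻¹ * D (g * h)⁻¹)
    (ht' : (iso h ⟨t, Ideal.mul_le_left ht⟩ : R) ∈ D g⁻¹),
    (iso g ⟨(iso h ⟨t, Ideal.mul_le_left ht⟩ : R), ht'⟩ : R) =
      (iso (g * h) ⟨t, Ideal.mul_le_right ht⟩ : R)

namespace UnitalPartialAction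

variable {G R : Type*} [Group G] [CommRing R] (α : UnitalPartialAction G R)

theorem e_mem (g : G) : α.e g ∈ α.D g := by
  rw [α.D_eq]; exact Ideal.mem_span_singleton_self _

/-- The everywhere defined map `x ↦ α_g (x 1_{g⁻¹})` of `R` into itself. -/
def act (g : G) (x : R) : R :=
  α.iso g ⟨x * α.e g⁻¹, Ideal.mul_mem_left _ x (α.e_mem _)⟩

theorem mem_D {g : G} {x : R} : x ∈ α.D g ↔ x * α.e g = x := by
  refine ⟨fun h => ?_, fun h => h ▸ Ideal.mul_mem_left _ x (α.e_mem _)⟩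
  rw [α.D_eq] at h
  obtain ⟨a, rfl⟩ := Ideal.mem_span_singleton'.1 h
  rw [mul_assoc, (α.e_idem g).eq]

theorem mem_D_mul_D {g h : G} {x : R} :
    x ∈ α.D g * α.D h ↔ x * α.e g = x ∧ x * α.e h = x := by
  refine ⟨fun H => ⟨α.mem_D.1 (Ideal.mul_le_left H), α.mem_D.1 (Ideal.mul_le_right H)⟩,
    fun H => ?_⟩
  rw [← H.2]
  exact Ideal.mul_mem_mul (α.mem_D.2 H.1) (α.e_mem _)

theorem act_mem (g : G) (x : R) : α.act g x ∈ α.D g := SetLike.coe_mem _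

theorem act_mul_e (g : G) (x : R) : α.act g x * α.e g = α.act g x := α.mem_D.1 (α.act_mem g x)

theorem act_eq (g : G) {x : R} (hx : x ∈ α.D g⁻¹) : α.act g x = α.iso g ⟨x, hx⟩ := by
  unfold act; congr 3; exact α.mem_D.1 hx

theorem act_add (g : G) (x y : R) : α.act g (x + y) = α.act g x + α.act g y := by
  simp only [act, ← Submodule.coe_add, ← map_add, AddMemClass.mk_add_mk, add_mul]

theorem act_mul (g : G) (x y : R) : α.act g (x * y) = α.act g x * α.act g y := by
  simp only [act, ← MulMemClass.coe_mul, ← map_mul, MulMemClass.mk_mul_mk]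
  congr 3
  linear_combination (-x * y) * (α.e_idem g⁻¹).eq

theorem act_zero (g : G) : α.act g 0 = 0 := by
  have := α.act_add g 0 0
  simpa using this

theorem act_neg (g : G) (x : R) : α.act g (-x) = -α.act g x := by
  have := α.act_add g (-x) x
  rw [neg_add_cancel, act_zero] at this
  linear_combination -this

theorem act_one (g : G) : α.act g 1 = α.e g := by
  obtain ⟨y, hy⟩ := (α.iso g).surjective ⟨α.e g, α.e_mem _⟩
  have h1 : α.act g y = α.e g := by
    rw [α.act_eq g y.2]; exact congrArg Subtype.val hy
  have h2 := α.act_mul g 1 y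
  rw [one_mul, h1, act_mul_e] at h2
  exact h2.symm

theorem e_one : α.e 1 = 1 := by
  have : (1 : R) ∈ α.D 1 := by rw [α.D_one]; trivial
  simpa using α.mem_D.1 this

theorem act_one_left (x : R) : α.act 1 x = x := by
  rw [act, α.iso_one]; simp [e_one]

theorem act_e_inv (g : G) : α.act g (α.e g⁻¹) = α.e g := by
  rw [← α.act_one g, act, act]; congr 3; rw [(α.e_idem _).eq, one_mul]

theorem act_mul_e_inv (g : G) (x : R) : α.act g (x * α.e g⁻¹) = α.act g x := by
  rw [act_mul, act_e_inv, act_mul_e]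

theorem act_e (g h : G) : α.act g (α.e h) = α.e g * α.e (g * h) := by
  have H := α.image_iso g h
  have h1 : α.act g (α.e h) ∈ α.D g * α.D (g * h) := by
    rw [← SetLike.mem_coe, ← H]
    refine ⟨⟨α.e h * α.e g⁻¹, Ideal.mul_mem_left _ _ (α.e_mem _)⟩, ?_, rfl⟩
    rw [Set.mem_ofPred_eq, mul_comm]
    exact Ideal.mul_mem_mul (α.e_mem _) (α.e_mem _)
  have h2 : α.e g * α.e (g * h) ∈ (α.D g * α.D (g * h) : Ideal R) :=
    Ideal.mul_mem_mul (α.e_mem _) (α.e_mem _)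
  rw [← SetLike.mem_coe, ← H] at h2
  obtain ⟨⟨y, hy⟩, hy1, hy2⟩ := h2
  have h3 : α.act g y = α.e g * α.e (g * h) := by rw [α.act_eq g hy]; exact hy2
  have h4 := α.act_mul g y (α.e h)
  rw [(α.mem_D_mul_D.1 hy1).2, h3] at h4
  rw [h4, mul_comm, ← mul_assoc, (α.mem_D_mul_D.1 h1).1, (α.mem_D_mul_D.1 h1).2]

theorem act_act (g h : G) (x : R) :
    α.act g (α.act h x) = α.act (g * h) x * α.e g := by
  have key : α.act h (α.e (g * h)⁻¹) = α.e h * α.e g⁻¹ := by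
    rw [act_e]; congr 2; group
  have ht : x * α.e h⁻¹ * α.e (g * h)⁻¹ ∈ α.D h⁻¹ * α.D (g * h)⁻¹ := by
    rw [mem_D_mul_D]
    constructor
    · linear_combination x * α.e (g * h)⁻¹ * (α.e_idem h⁻¹).eq
    · linear_combination x * α.e h⁻¹ * (α.e_idem (g * h)⁻¹).eq
  have h1 : α.act h (x * α.e h⁻¹ * α.e (g * h)⁻¹) = α.act h x * α.e g⁻¹ := by
    rw [act_mul, act_mul_e_inv, key, ← mul_assoc, act_mul_e]
  have h2 := α.act_eq h (Ideal.mul_le_left ht)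
  rw [h1] at h2
  have h3 : α.act h x * α.e g⁻¹ ∈ α.D g⁻¹ :=
    Ideal.mul_mem_left _ _ (α.e_mem _)
  have h4 := α.iso_iso g h _ ht (h2 ▸ h3)
  rw [← α.act_eq (g * h) (Ideal.mul_le_right ht), ← α.act_eq g (h2 ▸ h3), ← h2, act_mul_e_inv] at h4
  rw [h4, act_mul_e_inv, act_mul, act_e, mul_inv_cancel_right, ← mul_assoc, act_mul_e]

/-- The subring of invariants
`R^α = {r ∈ R | α_g (r 1_{g⁻¹}) = r 1_g for all g ∈ G}`. -/
def fixed : Subring R where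
  carrier := {r | ∀ g, α.act g r = r * α.e g}
  mul_mem' := fun {a b} ha hb g => by
    rw [act_mul, ha, hb]; linear_combination a * b * (α.e_idem g).eq
  one_mem' := fun g => by rw [act_one, one_mul]
  add_mem' := fun {a b} ha hb g => by rw [act_add, ha, hb, add_mul]
  zero_mem' := fun g => by rw [act_zero, zero_mul]
  neg_mem' := fun {a} ha g => by rw [act_neg, ha, neg_mul]

open Classical in
/-- `R ⊇ R^α` is an `α`-partial Galois extension: there are `x_i, y_i ∈ R`, `1 ≤ i ≤ m`, with
`∑ i, x_i α_g (y_i 1_{g⁻¹}) = δ_{1,g}` for all `g`. (Used for finite `G`.) -/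
def IsPartialGalois : Prop :=
  ∃ (m : ℕ) (x y : Fin m → R), ∀ g : G,
    ∑ i, x i * α.act g (y i) = if g = 1 then 1 else 0

/-! ### Partial cohomology in degree one

For an idempotent `e` of `R` the ring `R e`, with identity `e`, is `IsIdempotentElem.Corner`
(the set `e R e = R e`). -/

theorem e_mul_idem (g h : G) : IsIdempotentElem (α.e g * α.e (g * h)) :=
  (α.e_idem g).mul (α.e_idem (g * h))

/-- The multiplicative group `U(R e)`. -/
def CornerUnits {e : R} (he : IsIdempotentElem e) : Type _ := (he.Corner)ˣ

instance {e : R} (he : IsIdempotentElem e) : CommGroup (CornerUnits he) :=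
  inferInstanceAs (CommGroup (he.Corner)ˣ)

/-- The underlying element of `R`. -/
def CornerUnits.val {e : R} {he : IsIdempotentElem e} (u : CornerUnits he) : R :=
  (Units.val (α := he.Corner) u).1

/-- The unit of `R e` with value `x` and inverse `y` (relative to the identity `e`). -/
def cornerUnit {e : R} (he : IsIdempotentElem e) (x y : R) (hx : x * e = x) (hy : y * e = y)
    (hxy : x * y = e) : CornerUnits he :=
  Units.mk (α := he.Corner) ⟨x, x, by linear_combination e * hx + hx⟩
    ⟨y, y, by linear_combination e * hy + hy⟩ (Subtype.ext hxy)
    (Subtype.ext ((mul_comm y x).trans hxy))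

theorem corner_mul {e : R} {he : IsIdempotentElem e} (u : CornerUnits he) : u.val * e = u.val :=
  ((Subsemigroup.mem_corner_iff he).1 (Units.val (α := he.Corner) u).2).2

theorem corner_mul_inv {e : R} {he : IsIdempotentElem e} (u : CornerUnits he) :
    u.val * (u⁻¹).val = e :=
  congrArg Subtype.val (Units.mul_inv (α := he.Corner) u)

theorem corner_ext {e : R} {he : IsIdempotentElem e} {u v : CornerUnits he}
    (h : u.val = v.val) : u = v := Units.ext (α := he.Corner) (Subtype.ext h)

/-- The group `C⁰(G, α, R) = U(R)`. -/
abbrev C0 (_α : UnitalPartialAction G R) : Type _ := Rˣ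

/-- The group `C¹(G, α, R)` of functions `f` with `f g ∈ U(R 1_g)`. -/
abbrev C1 : Type _ := ∀ g : G, CornerUnits (α.e_idem g)

/-- The group `C²(G, α, R)` of functions `f` with `f (g, h) ∈ U(R 1_g 1_{gh})`. -/
abbrev C2 : Type _ := ∀ p : G × G, CornerUnits (α.e_mul_idem p.1 p.2)

variable {α} in
/-- The value `f g` of a `1`-cochain, as an element of `R`. -/
def C1.val (f : α.C1) (g : G) : R := (f g).val

/-- The coboundary map `(δ⁰ t) g = α_g (t 1_{g⁻¹}) t⁻¹`. -/
def δ0 : α.C0 →* α.C1 where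
  toFun t g := cornerUnit (α.e_idem g) (α.act g t * (t⁻¹ : Rˣ)) (α.act g (t⁻¹ : Rˣ) * t)
    (by rw [mul_right_comm, act_mul_e]) (by rw [mul_right_comm, act_mul_e])
    (by
      have h := α.act_mul g t (t⁻¹ : Rˣ)
      rw [Units.mul_inv, act_one] at h
      linear_combination (-1 : R) * h + α.act g t * α.act g (t⁻¹ : Rˣ) * Units.mul_inv t)
  map_one' := by
    funext g; apply corner_ext
    change α.act g ((1 : Rˣ) : R) * ((1⁻¹ : Rˣ) : R) = α.e g
    simp [act_one]
  map_mul' s t := by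
    funext g; apply corner_ext
    change α.act g ((s * t : Rˣ) : R) * (((s * t)⁻¹ : Rˣ) : R) =
      (α.act g s * (s⁻¹ : Rˣ)) * (α.act g t * (t⁻¹ : Rˣ))
    rw [mul_inv, Units.val_mul, Units.val_mul, act_mul]; ring

theorem C1.val_mul_e {α : UnitalPartialAction G R} (f : α.C1) (g : G) :
    f.val g * α.e g = f.val g := corner_mul _

theorem C1.val_mul_inv {α : UnitalPartialAction G R} (f : α.C1) (g : G) :
    f.val g * C1.val f⁻¹ g = α.e g := corner_mul_inv _

theorem C1.act_val_mul_inv {α : UnitalPartialAction G R} (f : α.C1) (g h : G) :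
    α.act g (f.val h) * α.act g (C1.val f⁻¹ h) = α.e g * α.e (g * h) := by
  rw [← act_mul, C1.val_mul_inv, act_e]

/-- The coboundary map `(δ¹ f) (g, h) = α_g (f h 1_{g⁻¹}) (f (g h))⁻¹ (f g)`, inverses being taken
in the ideals where the values lie. -/
def δ1 : α.C1 →* α.C2 where
  toFun f p := cornerUnit (α.e_mul_idem p.1 p.2)
    (α.act p.1 (f.val p.2) * C1.val f⁻¹ (p.1 * p.2) * f.val p.1)
    (α.act p.1 (C1.val f⁻¹ p.2) * f.val (p.1 * p.2) * C1.val f⁻¹ p.1)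
    (by
      have h1 := C1.val_mul_e f p.1
      have h2 := C1.val_mul_e f⁻¹ (p.1 * p.2)
      linear_combination α.act p.1 (f.val p.2) * f.val p.1 * α.e p.1 * h2 +
        α.act p.1 (f.val p.2) * C1.val f⁻¹ (p.1 * p.2) * h1)
    (by
      have h1 := C1.val_mul_e f⁻¹ p.1
      have h2 := C1.val_mul_e f (p.1 * p.2)
      linear_combination α.act p.1 (C1.val f⁻¹ p.2) * C1.val f⁻¹ p.1 * α.e p.1 * h2 +
        α.act p.1 (C1.val f⁻¹ p.2) * f.val (p.1 * p.2) * h1)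
    (by
      have h1 := C1.val_mul_inv f p.1
      have h2 := C1.val_mul_inv f (p.1 * p.2)
      have h3 := C1.act_val_mul_inv f p.1 p.2
      have i1 := (α.e_idem p.1).eq
      have i2 := (α.e_idem (p.1 * p.2)).eq
      calc _ = (α.act p.1 (f.val p.2) * α.act p.1 (C1.val f⁻¹ p.2)) *
            (f.val (p.1 * p.2) * C1.val f⁻¹ (p.1 * p.2)) * (f.val p.1 * C1.val f⁻¹ p.1) := by ring
        _ = _ := by
          rw [h1, h2, h3]
          linear_combination α.e (p.1 * p.2) * α.e (p.1 * p.2) * i1 + α.e p.1 * i2)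
  map_one' := by
    funext p; apply corner_ext
    change α.act p.1 (α.e p.2) * α.e (p.1 * p.2) * α.e p.1 = α.e p.1 * α.e (p.1 * p.2)
    rw [act_e]
    linear_combination α.e (p.1 * p.2) * α.e (p.1 * p.2) * (α.e_idem p.1).eq +
      α.e p.1 * (α.e_idem (p.1 * p.2)).eq
  map_mul' f f' := by
    funext p; apply corner_ext
    have h : ∀ g, C1.val (f * f')⁻¹ g = C1.val f⁻¹ g * C1.val f'⁻¹ g := fun g => by
      rw [mul_inv]; rfl
    change α.act p.1 (f.val p.2 * f'.val p.2) * C1.val (f * f')⁻¹ (p.1 * p.2) *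
        (f.val p.1 * f'.val p.1) =
      (α.act p.1 (f.val p.2) * C1.val f⁻¹ (p.1 * p.2) * f.val p.1) *
        (α.act p.1 (f'.val p.2) * C1.val f'⁻¹ (p.1 * p.2) * f'.val p.1)
    rw [act_mul, h]; ring

/-- The group `Z¹(G, α, R) = ker δ¹` of partial `1`-cocycles. -/
abbrev Z1 : Subgroup α.C1 := α.δ1.ker

/-- The group `B¹(G, α, R) = im δ⁰` of partial `1`-coboundaries. -/
abbrev B1 : Subgroup α.C1 := α.δ0.range

/-- The partial cohomology group `H¹(G, α, R) = ker δ¹ / im δ⁰`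
(note that `im δ⁰ ⊆ ker δ¹`, see `B1_le_Z1`). -/
abbrev H1 : Type _ := α.Z1 ⧸ α.B1.subgroupOf α.Z1

/-- The cohomology class `cls(f)` of a `1`-cocycle `f`. -/
def cls : α.Z1 →* α.H1 := QuotientGroup.mk' _

/-- The `1`-cocycle identity `f(g) α_g(f(h) 1_{g⁻¹}) = f(gh) 1_g`. -/
theorem mem_Z1 {f : α.C1} :
    f ∈ α.Z1 ↔ ∀ g h, f.val g * α.act g (f.val h) = f.val (g * h) * α.e g := by
  constructor
  · intro hf g h
    have H : α.act g (f.val h) * C1.val f⁻¹ (g * h) * f.val g = α.e g * α.e (g * h) :=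
      congrArg (fun u => (u (g, h)).val) (MonoidHom.mem_ker.1 hf)
    have h1 : α.act g (f.val h) * α.e (g * h) * f.val g = α.act g (f.val h) * f.val g := by
      have := α.act_mul g (f.val h) (α.e h)
      rw [C1.val_mul_e, act_e] at this
      linear_combination f.val g * this * (α.e (g * h) - 1) +
        α.act g (f.val h) * f.val g * α.e g * (α.e_idem (g * h)).eq
    have h2 := C1.val_mul_inv f (g * h)
    have h3 := C1.val_mul_e f (g * h)
    linear_combination f.val (g * h) * H - α.act g (f.val h) * f.val g * h2 - h1 + α.e g * h3
  · intro H
    refine MonoidHom.mem_ker.2 (funext fun p => corner_ext ?_)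
    change α.act p.1 (f.val p.2) * C1.val f⁻¹ (p.1 * p.2) * f.val p.1 = α.e p.1 * α.e (p.1 * p.2)
    linear_combination C1.val f⁻¹ (p.1 * p.2) * H p.1 p.2 +
      α.e p.1 * C1.val_mul_inv f (p.1 * p.2)

theorem B1_le_Z1 : α.B1 ≤ α.Z1 := by
  rintro _ ⟨t, rfl⟩
  rw [mem_Z1]
  intro g h
  change α.act g t * (t⁻¹ : Rˣ) * α.act g (α.act h t * (t⁻¹ : Rˣ)) =
    α.act (g * h) t * (t⁻¹ : Rˣ) * α.e g
  rw [act_mul, act_act]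
  have h1 := α.act_mul g t (t⁻¹ : Rˣ)
  rw [Units.mul_inv, act_one] at h1
  linear_combination (-(t⁻¹ : Rˣ) * α.act (g * h) t * α.e g) * h1 +
    (t⁻¹ : Rˣ) * α.act (g * h) t * (α.e_idem g).eq

/-- A `1`-cocycle is normalized. -/
theorem Z1_one (f : α.Z1) : f.1.val 1 = 1 := by
  have h := α.mem_Z1.1 f.2 1 1
  have h2 := C1.val_mul_inv f.1 1
  rw [act_one_left, mul_one, e_one] at h
  rw [e_one] at h2
  linear_combination (C1.val (f.1)⁻¹ 1) * h + (1 - f.1.val 1) * h2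

/-! ### The partial skew group ring -/

/-- The homogeneous components `D_g` of the partial skew group ring. -/
abbrev Comp (a : Additive G) : Type _ := α.D a.toMul

theorem comp_ext {a b : GradedMonoid α.Comp} (h1 : a.1 = b.1) (h2 : (a.2 : R) = b.2) : a = b := by
  obtain ⟨i, x⟩ := a
  obtain ⟨j, y⟩ := b
  obtain rfl : i = j := h1
  obtain rfl : x = y := Subtype.ext h2
  rfl

instance : GradedMonoid.GOne α.Comp where
  one := ⟨1, by rw [mem_D]; change 1 * α.e 1 = 1; rw [e_one, one_mul]⟩

/-- The multiplication `(r_g δ_g) (r'_h δ_h) = r_g α_g (r'_h 1_{g⁻¹}) δ_{gh}`. -/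
instance : GradedMonoid.GMul α.Comp where
  mul {a b} x y := ⟨(x : R) * α.act a.toMul y, by
    rw [mem_D]
    have h := α.act_mul a.toMul y (α.e b.toMul)
    rw [α.mem_D.1 y.2, act_e] at h
    have hx := α.mem_D.1 x.2
    change _ * α.e (a.toMul * b.toMul) = _
    linear_combination (x : R) * (α.e (a.toMul * b.toMul) - 1) * h +
      (x : R) * α.act a.toMul y * α.e a.toMul * (α.e_idem (a.toMul * b.toMul)).eq⟩

/-- The graded ring structure on `(D_g)_{g ∈ G}` with this multiplication and identity `1 δ_1`. -/
instance gRing : DirectSum.GRing α.Comp where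
  mul := GradedMonoid.GMul.mul
  mul_zero {a _} x := Subtype.ext (by
    change (x : R) * α.act a.toMul 0 = 0
    rw [act_zero, mul_zero])
  zero_mul y := Subtype.ext (zero_mul _)
  mul_add {a _} x y z := Subtype.ext (by
    change (x : R) * α.act a.toMul (y + z) = x * α.act a.toMul y + x * α.act a.toMul z
    rw [act_add, mul_add])
  add_mul x y z := Subtype.ext (add_mul (x : R) y _)
  one := GradedMonoid.GOne.one
  one_mul x := α.comp_ext (zero_add x.1) (by
    change 1 * α.act 1 (x.2 : R) = x.2
    rw [act_one_left, one_mul])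
  mul_one x := α.comp_ext (add_zero x.1) (by
    change (x.2 : R) * α.act x.1.toMul 1 = x.2
    rw [act_one]; exact α.mem_D.1 x.2.2)
  mul_assoc x y z := α.comp_ext (add_assoc x.1 y.1 z.1) (by
    change ((x.2 : R) * α.act x.1.toMul y.2) * α.act (x.1.toMul * y.1.toMul) z.2 =
      (x.2 : R) * α.act x.1.toMul ((y.2 : R) * α.act y.1.toMul z.2)
    rw [act_mul, act_act]
    have hx := α.mem_D.1 x.2.2
    linear_combination (-α.act x.1.toMul y.2 * α.act (x.1.toMul * y.1.toMul) z.2) * hx)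
  natCast n := n • GradedMonoid.GOne.one
  natCast_zero := zero_smul _ _
  natCast_succ n := succ_nsmul _ n
  intCast n := n • GradedMonoid.GOne.one
  intCast_ofNat n := natCast_zsmul _ n
  intCast_negSucc_ofNat n := negSucc_zsmul _ n

/-- The partial skew group ring `R ⋆_α G`, of all finite formal sums `∑ r_g δ_g` with
`r_g ∈ D_g`. -/
def SkewGroupRing : Type _ := ⨁ a : Additive G, α.Comp a

open Classical in
noncomputable instance : Ring α.SkewGroupRing :=
  inferInstanceAs (Ring (⨁ a : Additive G, α.Comp a))

open Classical in
/-- The element `r δ_g` of `R ⋆_α G`, for `r ∈ D_g`; it is additive in `r`. -/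
noncomputable def single (g : G) : α.D g →+ α.SkewGroupRing :=
  DirectSum.of α.Comp (Additive.ofMul g)

theorem single_congr {g h : G} {x : α.D g} {y : α.D h} (hg : g = h) (hx : (x : R) = y) :
    α.single g x = α.single h y := by
  subst hg; rw [Subtype.ext hx]

theorem single_mul_single (g h : G) (x : α.D g) (y : α.D h) (z : α.D (g * h))
    (hz : (z : R) = x * α.act g y) :
    α.single g x * α.single h y = α.single (g * h) z := by
  classical
  refine (DirectSum.of_mul_of (A := α.Comp) x y).trans ?_
  exact congrArg (DirectSum.of α.Comp (Additive.ofMul (g * h))) (Subtype.ext hz.symm)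

/-- The ring homomorphism `R → R ⋆_α G`, `r ↦ r δ_1`, through which every `R ⋆_α G`-module is
an `R`-module. -/
noncomputable def ofRing : R →+* α.SkewGroupRing where
  toFun r := α.single 1 ⟨r, by rw [mem_D, e_one, mul_one]⟩
  map_one' := rfl
  map_mul' r s := by
    rw [α.single_mul_single 1 1 _ _ ⟨r * s, by rw [mul_one, mem_D, e_one, mul_one]⟩
      (by change _ = r * α.act 1 s; rw [act_one_left])]
    exact α.single_congr (mul_one 1).symm rfl
  map_zero' := (α.single 1).map_zero
  map_add' r s := (α.single 1).map_add ⟨r, _⟩ ⟨s, _⟩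

theorem single_mul_ofRing (g : G) (x : α.D g) (r : R) (z : α.D g)
    (hz : (z : R) = x * α.act g r) : α.single g x * α.ofRing r = α.single g z := by
  refine (α.single_mul_single g 1 x ⟨r, by rw [mem_D, e_one, mul_one]⟩
    ⟨z, by rw [mul_one]; exact z.2⟩ hz).trans ?_
  exact α.single_congr (mul_one g) rfl

theorem ofRing_mul_single (g : G) (x : α.D g) (r : R) :
    α.ofRing r * α.single g x = α.single g (r • x) := by
  refine (α.single_mul_single 1 g ⟨r, by rw [mem_D, e_one, mul_one]⟩ x
    ⟨r * x, by rw [one_mul]; exact Ideal.mul_mem_left _ _ x.2⟩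
    (by change r * (x : R) = r * α.act 1 x; rw [act_one_left])).trans ?_
  exact α.single_congr (one_mul g) rfl

/-- The element `1_g δ_g`. -/
noncomputable def oneδ (g : G) : α.SkewGroupRing :=
  α.single g ⟨α.e g, α.e_mem _⟩

theorem oneδ_mul_ofRing (g : G) {r : R} (hr : r ∈ α.fixed) :
    α.oneδ g * α.ofRing r = α.ofRing r * α.oneδ g := by
  rw [oneδ, α.ofRing_mul_single]
  refine α.single_mul_ofRing g _ r _ ?_
  rw [hr g]
  change r * α.e g = α.e g * (r * α.e g)
  linear_combination (-r) * (α.e_idem g).eq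

/-- For an `R ⋆_α G`-module `M`, the subgroup
`M^G = {m ∈ M | (1_g δ_g) m = 1_g m for all g ∈ G}`. -/
def invariants (M : Type*) [AddCommGroup M] [Module α.SkewGroupRing M] : AddSubgroup M where
  carrier := {m | ∀ g, α.oneδ g • m = α.ofRing (α.e g) • m}
  add_mem' ha hb g := by rw [smul_add, smul_add, ha, hb]
  zero_mem' g := by rw [smul_zero, smul_zero]
  neg_mem' ha g := by rw [smul_neg, smul_neg, ha]

/-- `M^G` is an `R^α`-module through the `R`-module structure of `M`. -/
noncomputable instance invariantsModule (M : Type*) [AddCommGroup M] [Module α.SkewGroupRing M] :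
    Module α.fixed (α.invariants M) where
  smul r m := ⟨α.ofRing r • (m : M), fun g => by
    rw [← mul_smul, α.oneδ_mul_ofRing g r.2, mul_smul, m.2 g, ← mul_smul, ← mul_smul, ← map_mul,
      ← map_mul, mul_comm]⟩
  one_smul m := Subtype.ext (by
    change α.ofRing (1 : R) • (m : M) = m
    rw [map_one, one_smul])
  mul_smul r s m := Subtype.ext (by
    change α.ofRing ((r : R) * s) • (m : M) = α.ofRing r • α.ofRing s • (m : M)
    rw [map_mul, mul_smul])
  smul_zero r := Subtype.ext (smul_zero (α.ofRing r))
  smul_add r m n := Subtype.ext (smul_add (α.ofRing r) (m : M) n)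
  add_smul r s m := Subtype.ext (by
    change α.ofRing ((r : R) + s) • (m : M) = α.ofRing r • (m : M) + α.ofRing s • (m : M)
    rw [map_add, add_smul])
  zero_smul m := Subtype.ext (by
    change α.ofRing (0 : R) • (m : M) = 0
    rw [map_zero, zero_smul])

/-- The canonical action of `R ⋆_α G` on `R`, `(r_g δ_g) ▹ r = r_g α_g (r 1_{g⁻¹})`, as a ring
homomorphism to the additive endomorphisms of `R`. -/
noncomputable def toEnd : α.SkewGroupRing →+* AddMonoid.End R :=
  open Classical in
  DirectSum.toSemiring
    (fun a => AddMonoidHom.mk' (fun x : α.Comp a =>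
      (AddMonoidHom.mk' (fun r => (x : R) * α.act a.toMul r)
        (fun r s => by rw [act_add, mul_add]) : R →+ R))
      (fun x y => AddMonoidHom.ext fun r => add_mul (x : R) y _))
    (AddMonoidHom.ext fun r => by
      change (1 : R) * α.act 1 r = r
      rw [act_one_left, one_mul])
    (fun {a b} x y => AddMonoidHom.ext fun r => by
      change ((x : R) * α.act a.toMul y) * α.act (a.toMul * b.toMul) r =
        (x : R) * α.act a.toMul ((y : R) * α.act b.toMul r)
      rw [act_mul, act_act]
      have hx := α.mem_D.1 x.2
      linear_combination (-α.act a.toMul y * α.act (a.toMul * b.toMul) r) * hx)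

theorem toEnd_single (g : G) (x : α.D g) (r : R) :
    α.toEnd (α.single g x) r = x * α.act g r := by
  classical
  exact congrArg (fun φ : AddMonoid.End R => φ r)
    (DirectSum.toSemiring_of (A := α.Comp) _ _ _ (Additive.ofMul g) x)

/-- The ring endomorphism `θ_f (r_g δ_g) = r_g f(g) δ_g` of `R ⋆_α G` given by a `1`-cocycle
`f`. -/
noncomputable def theta (f : α.Z1) : α.SkewGroupRing →+* α.SkewGroupRing :=
  open Classical in
  DirectSum.toSemiring
    (fun a => (α.single a.toMul).comp (AddMonoidHom.mk'
      (fun x : α.Comp a =>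
        (⟨(x : R) * f.1.val a.toMul, Ideal.mul_mem_right _ _ x.2⟩ : α.D a.toMul))
      (fun x y => Subtype.ext (add_mul (x : R) y _))))
    (congrArg (α.single 1) (Subtype.ext (by
      change (1 : R) * f.1.val 1 = 1
      rw [one_mul, Z1_one])))
    (fun {a b} x y => by
      refine (α.single_mul_single a.toMul b.toMul _ _ _ ?_).symm
      change ((x : R) * α.act a.toMul y) * f.1.val (a.toMul * b.toMul) =
        ((x : R) * f.1.val a.toMul) * α.act a.toMul ((y : R) * f.1.val b.toMul)
      have hf := α.mem_Z1.1 f.2 a.toMul b.toMul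
      have hx := α.mem_D.1 x.2
      rw [act_mul]
      linear_combination (-(x : R) * α.act a.toMul y) * hf -
        α.act a.toMul y * f.1.val (a.toMul * b.toMul) * hx)

theorem theta_single (f : α.Z1) (g : G) (x : α.D g) :
    α.theta f (α.single g x) =
      α.single g ⟨(x : R) * f.1.val g, Ideal.mul_mem_right _ _ x.2⟩ := by
  classical
  exact DirectSum.toSemiring_of (A := α.Comp) _ _ _ (Additive.ofMul g) x

/-- The `R ⋆_α G`-module `R_f`: the additive group `R` with the twisted action
`(r_g δ_g) · r = θ_f (r_g δ_g) ▹ r`. -/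
def Twist (_f : α.Z1) : Type _ := R

instance (f : α.Z1) : AddCommGroup (α.Twist f) := inferInstanceAs (AddCommGroup R)

noncomputable instance (f : α.Z1) : Module α.SkewGroupRing (α.Twist f) :=
  letI : Module (AddMonoid.End R) (α.Twist f) :=
    inferInstanceAs (Module (AddMonoid.End R) R)
  Module.compHom _ (α.toEnd.comp (α.theta f))

/-- The action on `R_f` is `(x δ_g) · r = x f(g) α_g (r 1_{g⁻¹})`. -/
theorem smul_twist (f : α.Z1) (g : G) (x : α.D g) (r : α.Twist f) :
    α.single g x • r = ((x : R) * f.1.val g * α.act g r : R) := by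
  change α.toEnd (α.theta f (α.single g x)) r = _
  rw [theta_single]
  exact α.toEnd_single g _ r

end UnitalPartialAction

/-! Write `M_f` for the invariants of `R_f`, viewed as an `R^α`-submodule of `R`: those `r` with
`f(g) α_g(r 1_{g⁻¹}) = 1_g r` for all `g`. Working inside `R` turns the Picard group statement into
one about products of submodules. Multiplying the defining equations gives `M_f M_{f'} ⊆ M_{ff'}`,
and `M_1 = R^α`. So everything rests on `1 ∈ M_f M_{f⁻¹}`, the only place where the Galois condition
enters (`IsPartialGalois.one_mem_mul`).

Elements of `M_f` come from the twisted trace `tr_f(r) = ∑ f(g) α_g(r 1_{g⁻¹})`. A determinant trick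
yields `c` with `tr(c) = 1`, and then `∑ i, tr_f(c x_i) tr_{f⁻¹}(y_i) = tr(c) = 1`.

Hence `f ↦ M_f` is a homomorphism from cocycles to invertible submodules of `R`. Passing to
isomorphism classes gives a map to the Picard group. It kills coboundaries because the coboundary of
`t` has `M_f = R^α t⁻¹`, which is free. -/

namespace UnitalPartialAction

/-! ### Invariants of the twisted modules as submodules of `R` -/

variable {G R : Type*} [Group G] [CommRing R] (α : UnitalPartialAction G R)

theorem act_sum {ι : Type*} (g : G) (s : Finset ι) (x : ι → R) :
    α.act g (∑ i ∈ s, x i) = ∑ i ∈ s, α.act g (x i) :=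
  map_sum (AddMonoidHom.mk' (α.act g) (α.act_add g)) x s

/-- The invariants of `R_f`, as an `R^α`-submodule of `R`. -/
def invariantsSubmodule (f : α.Z1) : Submodule α.fixed R where
  carrier := {r | ∀ g, f.1.val g * α.act g r = α.e g * r}
  add_mem' {a b} ha hb g := by
    rw [act_add]; linear_combination ha g + hb g
  zero_mem' g := by rw [act_zero, mul_zero, mul_zero]
  smul_mem' s r hr g := by
    rw [Subring.smul_def, smul_eq_mul, act_mul, s.2 g]
    linear_combination (s : R) * α.e g * hr g + (s : R) * r * (α.e_idem g).eq

theorem mem_invariantsSubmodule {f : α.Z1} {r : R} :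
    r ∈ α.invariantsSubmodule f ↔ ∀ g, f.1.val g * α.act g r = α.e g * r := Iff.rfl

theorem oneδ_smul_twist (f : α.Z1) (g : G) (r : α.Twist f) :
    α.oneδ g • r = (f.1.val g * α.act g r : R) := by
  have h : α.oneδ g • r = (α.e g * f.1.val g * α.act g r : R) := α.smul_twist f g _ r
  rw [h, mul_comm (α.e g), f.1.val_mul_e]

theorem ofRing_smul_twist (f : α.Z1) (s r : R) :
    -- `β` is given explicitly because `r` is typed in `R`, while the action meant is the twisted
    -- one.
    HSMul.hSMul (β := α.Twist f) (α.ofRing s) r = s * r := by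
  refine (α.smul_twist f 1 _ r).trans ?_
  rw [Z1_one, act_one_left, mul_one]

theorem mem_invariants_twist {f : α.Z1} {r : α.Twist f} :
    r ∈ α.invariants (α.Twist f) ↔ (r : R) ∈ α.invariantsSubmodule f :=
  forall_congr' fun g => by
    rw [oneδ_smul_twist]
    exact Eq.congr_right (α.ofRing_smul_twist f (α.e g) r)

/-- `(R_f)^G` is isomorphic to the submodule `invariantsSubmodule` of `R`. -/
noncomputable def invariantsEquiv (f : α.Z1) :
    α.invariantsSubmodule f ≃ₗ[α.fixed] α.invariants (α.Twist f) where
  toFun r := ⟨(r : R), α.mem_invariants_twist.2 r.2⟩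
  invFun r := ⟨(r : α.Twist f), α.mem_invariants_twist.1 r.2⟩
  map_add' _ _ := rfl
  map_smul' s r := Subtype.ext (α.ofRing_smul_twist f s (r : R)).symm
  left_inv _ := rfl
  right_inv _ := rfl

theorem mul_mem_invariantsSubmodule {f f' : α.Z1} {r r' : R}
    (hr : r ∈ α.invariantsSubmodule f) (hr' : r' ∈ α.invariantsSubmodule f') :
    r * r' ∈ α.invariantsSubmodule (f * f') := fun g => by
  change f.1.val g * f'.1.val g * α.act g (r * r') = _
  rw [act_mul]
  linear_combination f'.1.val g * α.act g r' * hr g + α.e g * r * hr' g +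
    r * r' * (α.e_idem g).eq

theorem invariantsSubmodule_one : α.invariantsSubmodule 1 = 1 := by
  ext r
  rw [Submodule.mem_one, mem_invariantsSubmodule]
  have h (g : G) : α.e g * α.act g r = α.act g r := by rw [mul_comm, act_mul_e]
  constructor
  · intro hr
    exact ⟨⟨r, fun g => by rw [mul_comm r, ← hr g]; exact (h g).symm⟩, rfl⟩
  · rintro ⟨s, rfl⟩ g
    exact (h g).trans ((s.2 g).trans (mul_comm _ _))

theorem invariantsSubmodule_mul_le (f f' : α.Z1) :
    α.invariantsSubmodule f * α.invariantsSubmodule f' ≤ α.invariantsSubmodule (f * f') :=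
  Submodule.mul_le.2 fun _ hr _ hr' => α.mul_mem_invariantsSubmodule hr hr'

theorem act_eq_of_mem_fixed {s : R} (hs : s ∈ α.fixed) (g : G) (r : R) :
    α.act g (s * r) = s * α.act g r := by
  rw [act_mul, hs g, mul_assoc, mul_comm (α.e g), act_mul_e]

/-! ### Twisted traces and the Galois condition -/

section Trace

variable [Fintype G]

/-- The trace twisted by a cocycle, `r ↦ ∑ g, f(g) α_g(r 1_{g⁻¹})`. -/
def twistedTrace (f : α.Z1) (r : R) : R := ∑ g, f.1.val g * α.act g r

/-- By the cocycle identity, applying `α_h` and multiplying by `f(h)` permutes the summands by `g ↦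
hg`, up to the factor `1_h`. -/
theorem twistedTrace_mem (f : α.Z1) (r : R) :
    α.twistedTrace f r ∈ α.invariantsSubmodule f := fun h => by
  rw [twistedTrace, act_sum, Finset.mul_sum, Finset.mul_sum]
  refine Fintype.sum_equiv (Equiv.mulLeft h) _ _ fun g => ?_
  have hf := α.mem_Z1.1 f.2 h g
  rw [act_mul, act_act, Equiv.coe_mulLeft]
  linear_combination α.act (h * g) r * α.e h * hf +
    f.1.val (h * g) * α.act (h * g) r * (α.e_idem h).eq

theorem twistedTrace_one (r : R) : α.twistedTrace 1 r = ∑ g, α.act g r :=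
  Finset.sum_congr rfl fun g _ => (mul_comm (α.e g) _).trans (α.act_mul_e g r)

theorem trace_mem_fixed (r : R) : ∑ g, α.act g r ∈ α.fixed := by
  have h := α.twistedTrace_mem 1 r
  rw [invariantsSubmodule_one, twistedTrace_one] at h
  obtain ⟨s, hs⟩ := Submodule.mem_one.1 h
  exact hs ▸ s.2

/-- The trace `R → R^α` as an `R^α`-linear map. -/
def trace : R →ₗ[α.fixed] α.fixed where
  toFun r := ⟨∑ g, α.act g r, α.trace_mem_fixed r⟩
  map_add' r s := Subtype.ext (by
    simp only [act_add, Finset.sum_add_distrib, Subring.coe_add])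
  map_smul' s r := Subtype.ext (by
    simp only [Subring.smul_def, smul_eq_mul, RingHom.id_apply, Subring.coe_mul, Finset.mul_sum,
      α.act_eq_of_mem_fixed s.2])

theorem coe_trace (r : R) : (α.trace r : R) = ∑ g, α.act g r := rfl

variable {α}

/-- The Galois coordinates act as a dual basis, so `R` is finitely generated over `R^α` and `R = I
R`, where the ideal `I` is the image of the trace. Nakayama's lemma in its determinant form, with
faithfulness of `R`, forces `I = R^α`. -/
theorem IsPartialGalois.trace_surjective (hα : α.IsPartialGalois) :
    Function.Surjective α.trace := by
  obtain ⟨m, x, y, hxy⟩ := hα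
  -- Expanding the traces and summing over `i` first, only the term `g = 1` survives.
  have expand (r : R) : r = ∑ i, α.trace (y i * r) • x i := by
    simp only [Subring.smul_def, smul_eq_mul, coe_trace, Finset.sum_mul, act_mul]
    rw [Finset.sum_comm]
    calc r = ∑ g, (∑ i, x i * α.act g (y i)) * α.act g r := by
          classical
          simp only [hxy, ite_mul, one_mul, zero_mul, Finset.sum_ite_eq', Finset.mem_univ, if_true,
            act_one_left]
      _ = _ := Finset.sum_congr rfl fun g _ => by
          rw [Finset.sum_mul]; exact Finset.sum_congr rfl fun i _ => by ring
  have hfg : (⊤ : Submodule α.fixed R).FG :=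
    Submodule.fg_def.2 ⟨Set.range x, Set.finite_range x, top_unique fun r _ => by
      rw [expand r]
      exact Submodule.sum_mem _ fun i _ => Submodule.smul_mem _ _
        (Submodule.subset_span ⟨i, rfl⟩)⟩
  obtain ⟨s, hs, hs0⟩ := Submodule.exists_sub_one_mem_and_smul_eq_zero_of_fg_of_le_smul
    (LinearMap.range α.trace) ⊤ hfg fun r _ => by
      rw [expand r]
      exact Submodule.sum_mem _ fun i _ => Submodule.smul_mem_smul ⟨_, rfl⟩ trivial
  -- `s` annihilates `R`, in particular `1`.
  have hs' : s = 0 := Subtype.ext (by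
    simpa [Subring.smul_def] using hs0 1 trivial)
  rw [hs', zero_sub] at hs
  have h1 : (1 : α.fixed) ∈ LinearMap.range α.trace := neg_mem_iff.1 hs
  exact LinearMap.range_eq_top.1 ((Ideal.eq_top_iff_one _).2 h1)

/-- An explicit decomposition of `1` as a sum of products of twisted traces; the element `c` of
trace `1` corrects the sum, which without it would be `∑ 1_g`. -/
theorem IsPartialGalois.one_mem_mul (hα : α.IsPartialGalois) (f : α.Z1) :
    (1 : R) ∈ α.invariantsSubmodule f * α.invariantsSubmodule f⁻¹ := by
  classical
  obtain ⟨c, hc⟩ := hα.trace_surjective 1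
  replace hc : ∑ g, α.act g c = 1 := congrArg Subtype.val hc
  obtain ⟨m, x, y, hxy⟩ := hα
  -- Apply `α_g` to the Galois identity at `g⁻¹h`. The factor `1_g` appears because `α_g ∘ α_{g⁻¹h}`
  -- agrees with `α_h` only after multiplication by `1_g`.
  have orth (g h : G) :
      (∑ i, α.act g (x i) * α.act h (y i)) * α.e g = if g = h then α.e g else 0 := by
    have key := congrArg (α.act g) (hxy (g⁻¹ * h))
    rw [act_sum, apply_ite (α.act g), act_one, act_zero, inv_mul_eq_one] at key
    rw [← key, Finset.sum_mul]
    refine Finset.sum_congr rfl fun i _ => ?_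
    rw [act_mul, act_act, mul_inv_cancel_left, mul_assoc]
  have sum_eq : ∑ i, α.twistedTrace f (c * x i) * α.twistedTrace f⁻¹ (y i) = 1 := by
    calc ∑ i, α.twistedTrace f (c * x i) * α.twistedTrace f⁻¹ (y i)
        = ∑ g, ∑ h, f.1.val g * C1.val (f⁻¹ : α.Z1).1 h * α.act g c *
            ((∑ i, α.act g (x i) * α.act h (y i)) * α.e g) := by
          simp only [twistedTrace, Finset.sum_mul, Finset.mul_sum]
          refine Finset.sum_comm.trans (Eq.trans ?_ Finset.sum_comm)
          refine Finset.sum_congr rfl fun h _ => ?_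
          rw [Finset.sum_comm]
          refine Finset.sum_congr rfl fun g _ => Finset.sum_congr rfl fun i _ => ?_
          rw [act_mul]
          linear_combination (-C1.val (f⁻¹ : α.Z1).1 h * α.act g (x i) * α.act h (y i) *
            f.1.val g) * α.act_mul_e g c
      _ = ∑ g, α.act g c := by
          -- Only `h = g` remains, where the weights `f(g) f⁻¹(g)` multiply to `1_g`, already
          -- absorbed by `α_g(c)`.
          refine Finset.sum_congr rfl fun g _ => ?_
          simp only [orth, mul_ite, mul_zero, Finset.sum_ite_eq, Finset.mem_univ, if_true]
          have h1 : f.1.val g * C1.val (f⁻¹ : α.Z1).1 g = α.e g := f.1.val_mul_inv g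
          linear_combination α.act g c * α.e g * h1 + (α.e g + 1) * α.act_mul_e g c
      _ = 1 := hc
  rw [← sum_eq]
  exact Submodule.sum_mem _ fun i _ =>
    Submodule.mul_mem_mul (α.twistedTrace_mem f _) (α.twistedTrace_mem f⁻¹ _)

end Trace

/-! ### Invertible submodules and the map to the Picard group -/

variable {α}

theorem IsPartialGalois.invariantsSubmodule_mul_inv [Finite G] (hα : α.IsPartialGalois)
    (f : α.Z1) : α.invariantsSubmodule f * α.invariantsSubmodule f⁻¹ = 1 := by
  have := Fintype.ofFinite G
  refine le_antisymm ?_ (Submodule.one_le.2 (hα.one_mem_mul f))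
  have h := α.invariantsSubmodule_mul_le f f⁻¹
  rwa [mul_inv_cancel, invariantsSubmodule_one] at h

/-- The inclusion not already known follows from invertibility: multiply by `M_f M_{f⁻¹} = 1` and
use `M_{f⁻¹} M_{ff'} ⊆ M_{f'}`. -/
theorem IsPartialGalois.invariantsSubmodule_mul [Finite G] (hα : α.IsPartialGalois)
    (f f' : α.Z1) : α.invariantsSubmodule (f * f') =
      α.invariantsSubmodule f * α.invariantsSubmodule f' := by
  refine le_antisymm ?_ (α.invariantsSubmodule_mul_le f f')
  calc α.invariantsSubmodule (f * f')
      = α.invariantsSubmodule f * α.invariantsSubmodule f⁻¹ * α.invariantsSubmodule (f * f') := by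
        rw [hα.invariantsSubmodule_mul_inv, one_mul]
    _ = α.invariantsSubmodule f *
          (α.invariantsSubmodule f⁻¹ * α.invariantsSubmodule (f * f')) := mul_assoc _ _ _
    _ ≤ α.invariantsSubmodule f * α.invariantsSubmodule f' := by
        refine mul_le_mul_right ?_ _
        simpa using α.invariantsSubmodule_mul_le f⁻¹ (f * f')

/-- The homomorphism sending a cocycle `f` to the invertible submodule `(R_f)^G` of `R`. -/
def IsPartialGalois.toUnits [Finite G] (hα : α.IsPartialGalois) :
    α.Z1 →* (Submodule α.fixed R)ˣ where
  toFun f := ⟨α.invariantsSubmodule f, α.invariantsSubmodule f⁻¹,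
    hα.invariantsSubmodule_mul_inv f, (mul_comm _ _).trans (hα.invariantsSubmodule_mul_inv f)⟩
  map_one' := Units.ext α.invariantsSubmodule_one
  map_mul' f f' := Units.ext (hα.invariantsSubmodule_mul f f')

/-- After cancelling the unit `t`, the invariance condition on `r` says exactly that `t r` lies in
`R^α`. -/
theorem invariantsSubmodule_δ0 (t : Rˣ) (ht : α.δ0 t ∈ α.Z1) :
    α.invariantsSubmodule ⟨α.δ0 t, ht⟩ = Submodule.span α.fixed {((t⁻¹ : Rˣ) : R)} := by
  ext r
  have h (g : G) : (α.δ0 t).val g * α.act g r = α.e g * r ↔ α.act g (t * r) = t * r * α.e g := by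
    change α.act g t * (t⁻¹ : Rˣ) * α.act g r = _ ↔ _
    rw [act_mul, ← Units.mul_right_inj t]
    have : (t : R) * (α.act g t * (t⁻¹ : Rˣ) * α.act g r) = α.act g t * α.act g r := by
      linear_combination α.act g t * α.act g r * t.mul_inv
    rw [this, mul_comm (α.e g), mul_assoc]
  rw [Submodule.mem_span_singleton, mem_invariantsSubmodule]
  constructor
  · intro hr
    refine ⟨⟨t * r, fun g => (h g).1 (hr g)⟩, ?_⟩
    change (t : R) * r * (t⁻¹ : Rˣ) = r
    linear_combination r * t.mul_inv
  · rintro ⟨s, rfl⟩ g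
    refine (h g).2 ?_
    have : (t : R) * (s • ((t⁻¹ : Rˣ) : R)) = s := by
      change (t : R) * ((s : R) * (t⁻¹ : Rˣ)) = s
      linear_combination (s : R) * t.mul_inv
    rw [this]
    exact s.2 g

theorem IsPartialGalois.unitsToPic_toUnits_eq_one [Finite G] (hα : α.IsPartialGalois) (f : α.Z1)
    (hf : f ∈ α.B1.subgroupOf α.Z1) : Submodule.unitsToPic α.fixed R (hα.toUnits f) = 1 := by
  obtain ⟨f, hfZ⟩ := f
  obtain ⟨t, rfl⟩ := hf
  -- The kernel consists of the submodules spanned by a single unit of `R`; here that unit is `t⁻¹`.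
  rw [← MonoidHom.mem_ker, Submodule.ker_unitsToPic]
  exact ⟨t⁻¹, Units.ext (invariantsSubmodule_δ0 t hfZ).symm⟩

/-- The homomorphism `H¹(G, α, R) → Pic(R^α)`, `cls(f) ↦ [(R_f)^G]`. -/
noncomputable def IsPartialGalois.H1ToPic [Finite G] (hα : α.IsPartialGalois) :
    α.H1 →* CommRing.Pic α.fixed :=
  QuotientGroup.lift _ ((Submodule.unitsToPic α.fixed R).comp hα.toUnits)
    hα.unitsToPic_toUnits_eq_one

theorem IsPartialGalois.invertible_invariants [Finite G] (hα : α.IsPartialGalois) (f : α.Z1) :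
    Module.Invertible α.fixed (α.invariants (α.Twist f)) :=
  have : Module.Invertible α.fixed (α.invariantsSubmodule f) :=
    inferInstanceAs (Module.Invertible α.fixed (hα.toUnits f : Submodule α.fixed R))
  .congr (α.invariantsEquiv f)

end UnitalPartialAction

/-! ### Rank one and the conclusion -/

theorem Module.Invertible.rankAtStalk_eq_one {R M : Type*} [CommRing R] [AddCommGroup M]
    [Module R M] [Module.Invertible R M] (p : PrimeSpectrum R) :
    Module.rankAtStalk (R := R) M p = 1 := by
  simp [Module.rankAtStalk, Module.Invertible.finrank_eq_one]

theorem mainTheorem4 {G R : Type*} [Group G] [Finite G] [CommRing R]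
    (α : UnitalPartialAction G R) (hα : α.IsPartialGalois) :
    (∀ f : α.Z1,
      Module.Finite α.fixed (α.invariants (α.Twist f)) ∧
      Module.Projective α.fixed (α.invariants (α.Twist f)) ∧
      ∀ p : PrimeSpectrum α.fixed,
        Module.rankAtStalk (R := α.fixed) (α.invariants (α.Twist f)) p = 1) ∧
    ∃ (_ : ∀ f : α.Z1, Module.Invertible α.fixed (α.invariants (α.Twist f)))
      (φ₁ : α.H1 →* CommRing.Pic α.fixed),
      ∀ f : α.Z1,
        φ₁ (α.cls f) = CommRing.Pic.mk α.fixed (α.invariants (α.Twist f)) := by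
  have inv := hα.invertible_invariants
  refine ⟨fun f => ⟨inferInstance, inferInstance,
    Module.Invertible.rankAtStalk_eq_one⟩, inv, hα.H1ToPic, fun f => ?_⟩
  change Submodule.unitsToPic α.fixed R (hα.toUnits f) = _
  -- The left side unfolds to the class of `M_f`, which is isomorphic to the invariants of `R_f`.
  exact CommRing.Pic.mk_eq_mk_iff.2 ⟨α.invariantsEquiv f⟩
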